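/- Let $k\ge 2$ be an integer. Let $h,e,f$ be the Chevalley basis of $sl_2(\mathbb C)$ with $\langle a,b\rangle=\operatorname{tr}(ab)$, so that $\langle h,h\rangle=2$, $\langle e,f\rangle=1$, and write $a(n)$ for the action of $a\otimes t^n$ on a module of level $k$ for the affine Lie algebra $\widehat{sl}_2=sl_2\otimes\mathbb C[t,t^{-1}]\oplus\mathbb C C$, so that $$[a(m),b(n)]=[a,b](m+n)+m\langle a,b\rangle\delta_{m+n,0}\,k .$$ Let $V(k,0)$ be the Weyl module of level $k$, i.e. the vertex operator algebra generated by the vacuum $\mathbf 1$ with $a(n)\mathbf 1=0$ for $a\in sl_2$, $n\ge 0$. For $0\le i\le k$ let $L(k,i)$ be the irreducible highest weight $\widehat{sl}_2$-module of level $k$ and highest weight $i$ (the quotient of the Verma module by its maximal proper submodule), with highest weight vector $v^i$, so that $h(0)v^i=iv^i$, $e(0)v^i=0$ and $a(n)v^i=0$ for $a\in sl_2$, $n\ge1$; for $0\le j\le i$ put $v^{i,j}=\frac1{j!}f(0)^jv^i$. View $L(k,i)$ as a $V(k,0)$-module by $$Y\bigl(a^1(n_1)\cdots a^r(n_r)\mathbf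 1,x\bigr)=a^1(x)_{n_1}\cdots a^r(x)_{n_r}1,\qquad a(x)=\sum_{n\in\mathbb Z}a(n)x^{-n-1},$$ where $1$ denotes the identity operator and $$a(x)_nB(x)=\operatorname{Res}_{x_1}\bigl((x_1-x)^na(x_1)B(x)-(-x+x_1)^nB(x)a(x_1)\bigr),$$ and write $Y(u,x)=\sum_{n\in\mathbb Z}u_nx^{-n-1}$. Let $\omega,W^3,W^4,W^5\in V(k,0)$ be the vectors (of weights $2,3,4,5$) $$\omega=\tfrac1{2k(k+2)}\bigl(-kh(-2)\mathbf 1-h(-1)^2\mathbf 1+2ke(-1)f(-1)\mathbf 1\bigr),$$ $$\begin{aligned}W^3&=k^2h(-3)\mathbf 1+3kh(-2)h(-1)\mathbf 1+2h(-1)^3\mathbf 1-6kh(-1)e(-1)f(-1)\mathbf 1\\&\quad+3k^2e(-2)f(-1)\mathbf 1-3k^2e(-1)f(-2)\mathbf 1,\end{aligned}$$ $$\begin{aligned}W^4&=-2k^2(k^2+k+1)h(-4)\mathbf 1-8k(k^2+k+1)h(-3)h(-1)\mathbf 1-k(5k^2-6)h(-2)^2\mathbf 1\\&\quad-2k(11k+6)h(-2)h(-1)^2\mathbf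 1-(11k+6)h(-1)^4\mathbf 1+4k^2(6k-5)h(-2)e(-1)f(-1)\mathbf 1\\&\quad+4k(11k+6)h(-1)^2e(-1)f(-1)\mathbf 1-4k^2(5k+11)h(-1)e(-2)f(-1)\mathbf 1\\&\quad+4k^2(5k+11)h(-1)e(-1)f(-2)\mathbf 1+8k^2(k-3)(k-2)e(-3)f(-1)\mathbf 1\\&\quad-4k^2(3k^2-3k+8)e(-2)f(-2)\mathbf 1-2k^2(6k-5)e(-1)^2f(-1)^2\mathbf 1\\&\quad+8k^2(k^2+k+1)e(-1)f(-3)\mathbf 1,\end{aligned}$$ $$\begin{aligned}W^5&=-2k^3(k^2+3k+5)h(-5)\mathbf 1-10k^2(k^2+3k+5)h(-4)h(-1)\mathbf 1\\&\quad-5k^2(3k^2-4)h(-3)h(-2)\mathbf 1-5k(7k^2+12k+16)h(-3)h(-1)^2\mathbf 1\\&\quad-15k(3k^2-4)h(-2)^2h(-1)\mathbf 1-5k(19k+12)h(-2)h(-1)^3\mathbf 1-2(19k+12)h(-1)^5\mathbf 1\\&\quad+10k^2(4k^2-7k+8)h(-3)e(-1)f(-1)\mathbf 1+20k^2(10k-7)h(-2)h(-1)e(-1)f(-1)\mathbf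 1\\&\quad+10k(19k+12)h(-1)^3e(-1)f(-1)\mathbf 1-5k^2(11k^2-14k+12)h(-2)e(-2)f(-1)\mathbf 1\\&\quad-5k^2(17k+64)h(-1)^2e(-2)f(-1)\mathbf 1+15k^2(3k^2-4)h(-2)e(-1)f(-2)\mathbf 1\\&\quad+5k^2(17k+64)h(-1)^2e(-1)f(-2)\mathbf 1+30k^2(k-4)(k-3)h(-1)e(-3)f(-1)\mathbf 1\\&\quad-40k^2(k^2+3k+5)h(-1)e(-2)f(-2)\mathbf 1-10k^2(10k-7)h(-1)e(-1)^2f(-1)^2\mathbf 1\\&\quad+10k^2(3k^2+19k+8)h(-1)e(-1)f(-3)\mathbf 1-10k^3(k-4)(k-3)e(-4)f(-1)\mathbf 1\\&\quad+20k^3(k-4)(k-3)e(-3)f(-2)\mathbf 1+5k^3(10k-7)e(-2)e(-1)f(-1)^2\mathbf 1\\&\quad-10k^3(2k^2-4k+17)e(-2)f(-3)\mathbf 1-5k^3(10k-7)e(-1)^2f(-2)f(-1)\mathbf 1\\&\quad+10k^3(k^2+3k+5)e(-1)f(-4)\mathbf 1.\end{aligned}$$ Then for all $0\le j\le i\le k$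 the weight $0$ operators $o(\omega)=\omega_1$ and $o(W^p)=W^p_{p-1}$ ($p=3,4,5$) on $L(k,i)$ satisfy $$o(\omega)v^{i,j}=\tfrac{1}{2k(k+2)}\bigl(k(i-2j)-(i-2j)^2+2k(i-j+1)j\bigr)v^{i,j},$$ $$o(W^3)v^{i,j}=\bigl(k^2(i-2j)-3k(i-2j)^2+2(i-2j)^3-6k(i-2j)(i-j+1)j\bigr)v^{i,j},$$ $$\begin{aligned}o(W^4)v^{i,j}&=\bigl(2k^2(k^2+k+1)(i-2j)-k(13k^2+8k+2)(i-2j)^2+2k(11k+6)(i-2j)^3\\&\quad-(11k+6)(i-2j)^4+4k^2(k-3)(k-2)(i-j+1)j-4k^2(6k-5)(i-2j)(i-j+1)j\\&\quad+4k(11k+6)(i-2j)^2(i-j+1)j-2k^2(6k-5)(i-j+1)(i-j+2)(j-1)j\bigr)v^{i,j},\end{aligned}$$ $$\begin{aligned}o(W^5)v^{i,j}&=\bigl(-2k^3(k^2+3k+5)(i-2j)+5k^2(5k^2+6k+6)(i-2j)^2\\&\quad-20k(4k^2+3k+1)(i-2j)^3+5k(19k+12)(i-2j)^4-2(19k+12)(i-2j)^5\\&\quad+10k^2(5k^2-14k+20)(i-2j)(i-j+1)j-20k^2(10k-7)(i-2j)^2(i-j+1)j\\&\quad+10k(19k+12)(i-2j)^3(i-j+1)j-10k^2(10k-7)(i-2j)(i-j+1)(i-j+2)(j-1)j\bigr)v^{i,j}.\end{aligned}$$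 -/

import Mathlib

noncomputable section

open scoped VertexOperator

/-! ## Residue products of vertex operators -/

namespace VertexOperator

variable {M : Type*} [AddCommGroup M] [Module ℂ M]

/-- The coefficient of `x₁ ^ (m - i) x ^ i` in the expansion of `(x₁ - x) ^ m` in nonnegative
powers of `x`. -/
def expCoeff (m : ℤ) (i : ℕ) : ℤ := (-1) ^ i * Ring.choose m i

theorem exists_ncoeff_eq_zero (A : VertexOperator ℂ M) (v : M) :
    ∃ N : ℤ, ∀ n, N ≤ n → (A[[n]]) v = 0 := by
  refine ⟨-(HahnSeries.order ((HahnModule.of ℂ).symm (A v))), fun n hn => ?_⟩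
  exact ncoeff_eq_zero_of_lt_order A n v (by omega)

theorem ext_ncoeff {A B : VertexOperator ℂ M} (h : ∀ n v, (A[[n]]) v = (B[[n]]) v) : A = B := by
  apply HVertexOperator.coeff_inj
  funext n
  ext v
  rw [coeff_eq_ncoeff, coeff_eq_ncoeff]
  exact h _ v

/-- A vertex operator from its component operators `f n`, the coefficients of `x ^ (-n - 1)`. -/
def ofModes (f : ℤ → Module.End ℂ M) (hf : ∀ v, ∃ N : ℤ, ∀ n, N ≤ n → f n v = 0) :
    VertexOperator ℂ M :=
  VertexOperator.of_coeff (fun y => f (-y - 1)) (by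
    intro v
    obtain ⟨N, hN⟩ := hf v
    refine ⟨-N, fun y hy => ?_⟩
    by_contra hlt
    exact hy (hN _ (by omega)))

@[simp] theorem ncoeff_ofModes (f : ℤ → Module.End ℂ M) (hf) (n : ℤ) :
    (ofModes f hf)[[n]] = f n := by
  rw [ofModes, ncoeff_of_coeff]
  congr 1
  ring

/-- The identity field: the identity operator in degree `x ^ 0`. -/
def idField : VertexOperator ℂ M :=
  ofModes (fun n => if n = -1 then 1 else 0) (fun v => ⟨0, fun n hn => by
    rw [if_neg (by omega)]; rfl⟩)

theorem finsum_eq_sum_range {M : Type*} [AddCommGroup M] {f : ℕ → M} {N : ℕ} (h : ∀ i, N ≤ i → f i = 0) :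
    ∑ᶠ i, f i = ∑ i ∈ Finset.range N, f i := by
  apply finsum_eq_sum_of_support_subset
  intro i hi
  simp only [Finset.coe_range, Set.mem_Iio]
  by_contra hlt
  exact hi (h i (by omega))

theorem exists_nat_left (B : VertexOperator ℂ M) (n : ℤ) (v : M) :
    ∃ N : ℕ, ∀ i : ℕ, N ≤ i → (B[[n + i]]) v = 0 := by
  obtain ⟨N, hN⟩ := exists_ncoeff_eq_zero B v
  exact ⟨(N - n).toNat, fun i hi => hN _ (by omega)⟩

theorem exists_nat_right (A : VertexOperator ℂ M) (v : M) :
    ∃ N : ℕ, ∀ i : ℕ, N ≤ i → (A[[(i : ℤ)]]) v = 0 := by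
  obtain ⟨N, hN⟩ := exists_ncoeff_eq_zero A v
  exact ⟨N.toNat, fun i hi => hN _ (by omega)⟩

/-- The coefficient of `x ^ (-n - 1)` in `Res_{x₁} (x₁ - x) ^ m A(x₁) B(x)`, where
`(x₁ - x) ^ m` is expanded in nonnegative powers of `x`. -/
def leftCoeff (A B : VertexOperator ℂ M) (m n : ℤ) : Module.End ℂ M where
  toFun v := ∑ᶠ i : ℕ, expCoeff m i • (A[[m - i]]) ((B[[n + i]]) v)
  map_add' v w := by
    obtain ⟨N₁, h₁⟩ := exists_nat_left B n v
    obtain ⟨N₂, h₂⟩ := exists_nat_left B n w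
    simp only [map_add, smul_add]
    rw [finsum_add_distrib]
    · exact (Set.finite_lt_nat N₁).subset fun i hi => by
        by_contra hlt
        exact hi (by simp [h₁ i (by simpa using hlt)])
    · exact (Set.finite_lt_nat N₂).subset fun i hi => by
        by_contra hlt
        exact hi (by simp [h₂ i (by simpa using hlt)])
  map_smul' c v := by
    simp only [map_smul, RingHom.id_apply, smul_finsum]
    exact finsum_congr fun i => smul_comm _ _ _

/-- The coefficient of `x ^ (-n - 1)` in `Res_{x₁} (-x + x₁) ^ m B(x) A(x₁)`, where
`(-x + x₁) ^ m` is expanded in nonnegative powers of `x₁`. -/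
def rightCoeff (A B : VertexOperator ℂ M) (m n : ℤ) : Module.End ℂ M where
  toFun v := m.negOnePow • ∑ᶠ i : ℕ, expCoeff m i • (B[[m + n - i]]) ((A[[(i : ℤ)]]) v)
  map_add' v w := by
    obtain ⟨N₁, h₁⟩ := exists_nat_right A v
    obtain ⟨N₂, h₂⟩ := exists_nat_right A w
    simp only [map_add, smul_add]
    rw [finsum_add_distrib, smul_add]
    · exact (Set.finite_lt_nat N₁).subset fun i hi => by
        by_contra hlt
        exact hi (by simp [h₁ i (by simpa using hlt)])
    · exact (Set.finite_lt_nat N₂).subset fun i hi => by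
        by_contra hlt
        exact hi (by simp [h₂ i (by simpa using hlt)])
  map_smul' c v := by
    have h : ∀ i : ℕ, expCoeff m i • (B[[m + n - i]]) ((A[[(i : ℤ)]]) (c • v)) =
        c • expCoeff m i • (B[[m + n - i]]) ((A[[(i : ℤ)]]) v) := fun i => by
      rw [map_smul, map_smul, smul_comm]
    simp only [h, RingHom.id_apply, ← smul_finsum, Units.smul_def]
    exact smul_comm _ _ _

theorem leftCoeff_apply (A B : VertexOperator ℂ M) (m n : ℤ) (v : M) {N : ℕ}
    (h : ∀ i : ℕ, N ≤ i → (B[[n + i]]) v = 0) :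
    leftCoeff A B m n v = ∑ i ∈ Finset.range N, expCoeff m i • (A[[m - i]]) ((B[[n + i]]) v) :=
  finsum_eq_sum_range fun i hi => by rw [h i hi, map_zero, smul_zero]

theorem rightCoeff_apply (A B : VertexOperator ℂ M) (m n : ℤ) (v : M) {N : ℕ}
    (h : ∀ i : ℕ, N ≤ i → (A[[(i : ℤ)]]) v = 0) :
    rightCoeff A B m n v = m.negOnePow •
      ∑ i ∈ Finset.range N, expCoeff m i • (B[[m + n - i]]) ((A[[(i : ℤ)]]) v) := by
  change m.negOnePow • (∑ᶠ i : ℕ, expCoeff m i • (B[[m + n - i]]) ((A[[(i : ℤ)]]) v)) = _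
  rw [finsum_eq_sum_range (N := N)]
  intro i hi
  rw [h i hi, map_zero, smul_zero]

/-- `B ↦ Res_{x₁} (x₁ - x) ^ m A(x₁) B(x)`. -/
def leftRes (A : VertexOperator ℂ M) (m : ℤ) : Module.End ℂ (VertexOperator ℂ M) where
  toFun B := ofModes (leftCoeff A B m) fun v => by
    obtain ⟨N, hN⟩ := exists_ncoeff_eq_zero B v
    refine ⟨N, fun n hn => ?_⟩
    rw [leftCoeff_apply A B m n v (N := 0) fun i _ => hN _ (by omega)]
    rfl
  map_add' B C := by
    refine ext_ncoeff fun n v => ?_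
    obtain ⟨N₁, h₁⟩ := exists_nat_left B n v
    obtain ⟨N₂, h₂⟩ := exists_nat_left C n v
    have hB : ∀ i : ℕ, max N₁ N₂ ≤ i → (B[[n + i]]) v = 0 := fun i hi => h₁ i (by omega)
    have hC : ∀ i : ℕ, max N₁ N₂ ≤ i → (C[[n + i]]) v = 0 := fun i hi => h₂ i (by omega)
    simp only [ncoeff_ofModes, map_add, Pi.add_apply, LinearMap.add_apply]
    rw [leftCoeff_apply _ _ _ _ _ hB, leftCoeff_apply _ _ _ _ _ hC,
      leftCoeff_apply _ _ _ _ _ (N := max N₁ N₂) (fun i hi => by simp [hB i hi, hC i hi]),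
      ← Finset.sum_add_distrib]
    exact Finset.sum_congr rfl fun i _ => by simp
  map_smul' c B := by
    refine ext_ncoeff fun n v => ?_
    obtain ⟨N, h⟩ := exists_nat_left B n v
    simp only [ncoeff_ofModes, map_smul, Pi.smul_apply, LinearMap.smul_apply, RingHom.id_apply]
    rw [leftCoeff_apply _ _ _ _ _ h,
      leftCoeff_apply _ _ _ _ _ (N := N) (fun i hi => by simp [h i hi]), Finset.smul_sum]
    exact Finset.sum_congr rfl fun i _ => by simp [smul_comm c]

/-- `B ↦ Res_{x₁} (-x + x₁) ^ m B(x) A(x₁)`. -/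
def rightRes (A : VertexOperator ℂ M) (m : ℤ) : Module.End ℂ (VertexOperator ℂ M) where
  toFun B := ofModes (rightCoeff A B m) fun v => by
    obtain ⟨I, hI⟩ := exists_nat_right A v
    choose K hK using fun i : ℕ => exists_ncoeff_eq_zero B ((A[[(i : ℤ)]]) v)
    refine ⟨∑ i ∈ Finset.range I, (|K i| + |m| + I), fun n hn => ?_⟩
    rw [rightCoeff_apply A B m n v hI, Finset.sum_eq_zero, smul_zero]
    intro i hi
    rw [hK i _ ?_, smul_zero]
    have h₁ := Finset.single_le_sum (f := fun i => |K i| + |m| + (I : ℤ))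
      (fun j _ => by positivity) hi
    have h₂ := le_abs_self (K i)
    have h₃ := neg_abs_le m
    have h₄ := Finset.mem_range.1 hi
    omega
  map_add' B C := by
    refine ext_ncoeff fun n v => ?_
    obtain ⟨N, h⟩ := exists_nat_right A v
    simp only [ncoeff_ofModes, map_add, Pi.add_apply, LinearMap.add_apply]
    rw [rightCoeff_apply _ _ _ _ _ h, rightCoeff_apply _ _ _ _ _ h,
      rightCoeff_apply _ _ _ _ _ h, ← smul_add, ← Finset.sum_add_distrib]
    congr 1
    exact Finset.sum_congr rfl fun i _ => by simp
  map_smul' c B := by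
    refine ext_ncoeff fun n v => ?_
    obtain ⟨N, h⟩ := exists_nat_right A v
    simp only [ncoeff_ofModes, map_smul, Pi.smul_apply, LinearMap.smul_apply, RingHom.id_apply]
    rw [rightCoeff_apply _ _ _ _ _ h, rightCoeff_apply _ _ _ _ _ h, Units.smul_def,
      Units.smul_def, smul_comm c, Finset.smul_sum (r := c)]
    congr 1
    exact Finset.sum_congr rfl fun i _ => by simp [smul_comm c]

/-- The residue product
`A(x)_m B(x) = Res_{x₁} ((x₁ - x) ^ m A(x₁) B(x) - (-x + x₁) ^ m B(x) A(x₁))`,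
as a linear operator in `B`. -/
def resProd (A : VertexOperator ℂ M) (m : ℤ) : Module.End ℂ (VertexOperator ℂ M) :=
  leftRes A m - rightRes A m

theorem leftRes_apply (A B : VertexOperator ℂ M) (m n : ℤ) (v : M) {N : ℕ}
    (h : ∀ i : ℕ, N ≤ i → (B[[n + i]]) v = 0) :
    ((leftRes A m B)[[n]]) v =
      ∑ i ∈ Finset.range N, expCoeff m i • (A[[m - i]]) ((B[[n + i]]) v) := by
  rw [← leftCoeff_apply A B m n v h]
  simp [leftRes]

theorem rightRes_apply (A B : VertexOperator ℂ M) (m n : ℤ) (v : M) {N : ℕ}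
    (h : ∀ i : ℕ, N ≤ i → (A[[(i : ℤ)]]) v = 0) :
    ((rightRes A m B)[[n]]) v = m.negOnePow •
      ∑ i ∈ Finset.range N, expCoeff m i • (B[[m + n - i]]) ((A[[(i : ℤ)]]) v) := by
  rw [← rightCoeff_apply A B m n v h]
  simp [rightRes]


theorem resProd_add (A B : VertexOperator ℂ M) (m : ℤ) :
    resProd (A + B) m = resProd A m + resProd B m := by
  have h₁ : leftRes (A + B) m = leftRes A m + leftRes B m := by
    refine LinearMap.ext fun D => ext_ncoeff fun n v => ?_
    obtain ⟨N, h⟩ := exists_nat_left D n v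
    simp only [LinearMap.add_apply, map_add, Pi.add_apply]
    rw [leftRes_apply _ _ _ _ _ h, leftRes_apply _ _ _ _ _ h, leftRes_apply _ _ _ _ _ h,
      ← Finset.sum_add_distrib]
    exact Finset.sum_congr rfl fun i _ => by simp
  have h₂ : rightRes (A + B) m = rightRes A m + rightRes B m := by
    refine LinearMap.ext fun D => ext_ncoeff fun n v => ?_
    obtain ⟨N₁, g₁⟩ := exists_nat_right A v
    obtain ⟨N₂, g₂⟩ := exists_nat_right B v
    have hA : ∀ i : ℕ, max N₁ N₂ ≤ i → (A[[(i : ℤ)]]) v = 0 := fun i hi => g₁ i (by omega)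
    have hB : ∀ i : ℕ, max N₁ N₂ ≤ i → (B[[(i : ℤ)]]) v = 0 := fun i hi => g₂ i (by omega)
    simp only [LinearMap.add_apply, map_add, Pi.add_apply]
    rw [rightRes_apply _ _ _ _ _ hA, rightRes_apply _ _ _ _ _ hB,
      rightRes_apply _ _ _ _ _ (N := max N₁ N₂) (fun i hi => by simp [hA i hi, hB i hi]),
      ← smul_add, ← Finset.sum_add_distrib]
    congr 1
    exact Finset.sum_congr rfl fun i _ => by simp
  rw [resProd, resProd, resProd, h₁, h₂]
  abel

theorem resProd_smul (c : ℂ) (A : VertexOperator ℂ M) (m : ℤ) :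
    resProd (c • A) m = c • resProd A m := by
  have h₁ : leftRes (c • A) m = c • leftRes A m := by
    refine LinearMap.ext fun D => ext_ncoeff fun n v => ?_
    obtain ⟨N, h⟩ := exists_nat_left D n v
    simp only [LinearMap.smul_apply, map_smul, Pi.smul_apply]
    rw [leftRes_apply _ _ _ _ _ h, leftRes_apply _ _ _ _ _ h, Finset.smul_sum]
    exact Finset.sum_congr rfl fun i _ => by simp [smul_comm c]
  have h₂ : rightRes (c • A) m = c • rightRes A m := by
    refine LinearMap.ext fun D => ext_ncoeff fun n v => ?_
    obtain ⟨N, h⟩ := exists_nat_right A v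
    simp only [LinearMap.smul_apply, map_smul, Pi.smul_apply]
    rw [rightRes_apply _ _ _ _ _ h,
      rightRes_apply _ _ _ _ _ (N := N) (fun i hi => by simp [h i hi]), Units.smul_def,
      Units.smul_def, smul_comm c, Finset.smul_sum (r := c)]
    congr 1
    exact Finset.sum_congr rfl fun i _ => by simp [smul_comm c]
  rw [resProd, resProd, h₁, h₂]
  refine LinearMap.ext fun D => ?_
  simp only [LinearMap.sub_apply, LinearMap.smul_apply, smul_sub]

/-! ### Commutators of residue products -/

theorem expCoeff_zero (m : ℤ) : expCoeff m 0 = 1 := by simp [expCoeff]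

theorem expCoeff_vandermonde (m n : ℤ) (s : ℕ) :
    ∑ p ∈ Finset.HasAntidiagonal.antidiagonal s, expCoeff m p.1 * expCoeff n p.2 = expCoeff (m + n) s := by
  rw [expCoeff, Ring.add_choose_eq s (Commute.all m n), Finset.mul_sum]
  refine Finset.sum_congr rfl fun p hp => ?_
  rw [← Finset.HasAntidiagonal.mem_antidiagonal.1 hp, expCoeff, expCoeff, pow_add]
  ring

theorem expCoeff_absorb (m : ℤ) (i : ℕ) :
    (m - i) * expCoeff m i = m * expCoeff (m - 1) i := by
  have h₁ := Ring.choose_smul_choose m (Nat.le_succ i)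
  have h₂ := Ring.choose_smul_choose m (Nat.succ_le_succ (Nat.zero_le i))
  have h₃ : Nat.choose (i + 1) i = Nat.choose (i + 1) 1 := by simp
  simp only [Nat.succ_eq_add_one, zero_add, Nat.add_sub_cancel_left, Nat.add_sub_cancel,
    Ring.choose_one_right, h₃, Nat.cast_one] at h₁ h₂
  rw [h₁] at h₂
  rw [expCoeff, expCoeff]
  linear_combination (-1) ^ i * h₂

theorem expCoeff_vandermonde_central (m n : ℤ) (s : ℕ) (hs : m + n = s) :
    ∑ p ∈ Finset.HasAntidiagonal.antidiagonal s, expCoeff m p.1 * expCoeff n p.2 * (m - p.1) =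
      if s = 0 then m else 0 := by
  have : ∀ p ∈ Finset.HasAntidiagonal.antidiagonal s, expCoeff m p.1 * expCoeff n p.2 * (m - p.1) =
      m * (expCoeff (m - 1) p.1 * expCoeff n p.2) := fun p _ => by
    linear_combination expCoeff n p.2 * expCoeff_absorb m p.1
  rw [Finset.sum_congr rfl this, ← Finset.mul_sum, expCoeff_vandermonde]
  have h : m - 1 + n = (s : ℤ) - 1 := by omega
  rw [h, expCoeff]
  rcases s with _ | s
  · simp
  · have : ((s + 1 : ℕ) : ℤ) - 1 = (s : ℤ) := by push_cast; ring
    rw [this, Ring.choose_natCast]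
    simp

/-- A sum over a square can be computed along antidiagonals if the terms outside the triangle
vanish. -/
theorem sum_square_eq_sum_antidiagonal {X : Type*} [AddCommMonoid X] (N : ℕ) (f : ℕ → ℕ → X)
    (hf : ∀ i j, N ≤ i + j → f i j = 0) :
    ∑ i ∈ Finset.range N, ∑ j ∈ Finset.range N, f i j =
      ∑ s ∈ Finset.range N, ∑ p ∈ Finset.HasAntidiagonal.antidiagonal s, f p.1 p.2 := by
  rw [← Finset.sum_product', Finset.sum_sigma']
  symm
  refine Finset.sum_of_injOn (fun x => x.2) ?_ ?_ ?_ ?_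
  · rintro ⟨s, p⟩ h ⟨t, q⟩ h' e
    simp only [Finset.coe_sigma, Set.mem_sigma_iff, Finset.mem_coe, Finset.HasAntidiagonal.mem_antidiagonal] at h h'
    obtain rfl : p = q := e
    obtain rfl : s = t := by rw [← h.2, ← h'.2]
    rfl
  · rintro ⟨s, p⟩ h
    simp only [Finset.coe_sigma, Set.mem_sigma_iff, Finset.mem_coe, Finset.HasAntidiagonal.mem_antidiagonal,
      Finset.mem_range, Finset.mem_product] at h ⊢
    omega
  · rintro ⟨i, j⟩ _ h
    refine hf i j ?_
    by_contra hlt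
    exact h ⟨⟨i + j, (i, j)⟩, by simpa using hlt, rfl⟩
  · intro x _
    rfl

variable {A B C : VertexOperator ℂ M} {κ : ℂ}

/-- The component operators of `A`, `B`, `C` satisfy `[A_m, B_n] = C_{m+n} + m κ δ_{m+n,0}`. -/
def AffineRel (A B C : VertexOperator ℂ M) (κ : ℂ) : Prop :=
  ∀ (m n : ℤ) (v : M), (A[[m]]) ((B[[n]]) v) = (B[[n]]) ((A[[m]]) v) + (C[[m + n]]) v +
    (if m + n = 0 then m * κ else 0) • v

theorem leftRes_rightRes_comm (A B D : VertexOperator ℂ M) (m n : ℤ) :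
    leftRes A m (rightRes B n D) = rightRes B n (leftRes A m D) := by
  refine ext_ncoeff fun p v => ?_
  obtain ⟨J, hJ⟩ := exists_nat_right B v
  choose I hI using fun j : ℕ => exists_nat_left D (n + p - j) ((B[[(j : ℤ)]]) v)
  obtain ⟨I₀, hI₀⟩ := exists_nat_left (rightRes B n D) p v
  set N := I₀ + ∑ j ∈ Finset.range J, I j with hN
  have hle : ∀ j < J, I j ≤ N := fun j hj => by
    have := Finset.single_le_sum (f := I) (fun _ _ => Nat.zero_le _) (Finset.mem_range.2 hj)
    omega
  rw [leftRes_apply A _ m p v (N := N) (fun i hi => hI₀ i (by omega)),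
    rightRes_apply B _ n p v hJ]
  simp only [rightRes_apply B D n _ v hJ]
  have h : ∀ j ∈ Finset.range J,
      expCoeff n j • ((leftRes A m D)[[n + p - j]]) ((B[[(j : ℤ)]]) v) =
      ∑ i ∈ Finset.range N, expCoeff n j • expCoeff m i •
        (A[[m - i]]) ((D[[n + p - j + i]]) ((B[[(j : ℤ)]]) v)) := fun j hj => by
    rw [leftRes_apply A D m _ _ (N := N)
      (fun i hi => hI j i ((hle j (Finset.mem_range.1 hj)).trans hi)), Finset.smul_sum]
  rw [Finset.sum_congr rfl h, Finset.sum_comm, Finset.smul_sum]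
  refine Finset.sum_congr rfl fun i _ => ?_
  simp only [Units.smul_def, map_zsmul, map_sum]
  rw [smul_comm]
  congr 1
  rw [Finset.smul_sum]
  refine Finset.sum_congr rfl fun j _ => ?_
  rw [smul_comm]
  congr 4
  ring_nf

theorem leftRes_comm (h : AffineRel A B C κ) (m n : ℤ) (D : VertexOperator ℂ M) :
    leftRes A m (leftRes B n D) = leftRes B n (leftRes A m D) + leftRes C (m + n) D +
      (if m + n = 0 then m * κ else 0) • D := by
  refine ext_ncoeff fun p v => ?_
  obtain ⟨N₀, h₀⟩ := exists_ncoeff_eq_zero D v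
  set N := (N₀ - p).toNat + 1 with hN
  have hD : ∀ q : ℤ, p + N ≤ q → (D[[q]]) v = 0 := fun q hq => h₀ q (by omega)
  have hL : ∀ (X : VertexOperator ℂ M) (r q : ℤ), p + N ≤ q → ((leftRes X r D)[[q]]) v = 0 :=
    fun X r q hq => by
      rw [leftRes_apply X D r q v (N := 0) (fun i _ => hD _ (by omega))]
      rfl
  have key : ∀ (X Z : VertexOperator ℂ M) (r t : ℤ), ((leftRes X r (leftRes Z t D))[[p]]) v =
      ∑ i ∈ Finset.range N, ∑ j ∈ Finset.range N, (expCoeff r i * expCoeff t j) •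
        (X[[r - i]]) ((Z[[t - j]]) ((D[[p + i + j]]) v)) := by
    intro X Z r t
    rw [leftRes_apply X _ r p v (N := N) (fun i hi => hL _ _ _ (by omega))]
    refine Finset.sum_congr rfl fun i _ => ?_
    rw [leftRes_apply Z D t _ v (N := N) (fun j hj => hD _ (by omega)), map_sum, Finset.smul_sum]
    refine Finset.sum_congr rfl fun j _ => ?_
    rw [map_zsmul, mul_smul]
  simp only [map_add, map_smul, Pi.add_apply, LinearMap.add_apply, Pi.smul_apply,
    LinearMap.smul_apply]
  rw [key, key, leftRes_apply C D (m + n) p v (N := N) (fun i hi => hD _ (by omega)),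
    Finset.sum_comm (s := Finset.range N) (t := Finset.range N)
      (f := fun i j => (expCoeff n i * expCoeff m j) •
        (B[[n - i]]) ((A[[m - j]]) ((D[[p + i + j]]) v)))]
  have e₁ : ∀ i j : ℕ, (expCoeff m i * expCoeff n j) •
        (A[[m - i]]) ((B[[n - j]]) ((D[[p + i + j]]) v)) =
      (expCoeff n j * expCoeff m i) • (B[[n - j]]) ((A[[m - i]]) ((D[[p + j + i]]) v)) +
      ((expCoeff m i * expCoeff n j) • (C[[m + n - (i + j : ℕ)]]) ((D[[p + (i + j : ℕ)]]) v) +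
      (expCoeff m i * expCoeff n j) • (if m + n = (i + j : ℕ) then ((m - i : ℤ) : ℂ) * κ else 0) •
        (D[[p + (i + j : ℕ)]]) v) := by
    intro i j
    have a₁ : p + i + j = p + (i + j : ℕ) := by push_cast; ring
    have a₂ : p + j + i = p + (i + j : ℕ) := by push_cast; ring
    have a₃ : m - i + (n - j) = m + n - (i + j : ℕ) := by push_cast; ring
    have a₄ : (m + n - (i + j : ℕ) = 0) = (m + n = (i + j : ℕ)) := by rw [sub_eq_zero]
    rw [h, a₁, a₂, a₃, smul_add, smul_add, mul_comm (expCoeff n j), add_assoc]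
    simp only [a₄]
  simp only [e₁, Finset.sum_add_distrib]
  rw [add_assoc]
  congr 1
  congr 1
  · rw [sum_square_eq_sum_antidiagonal N (fun i j => (expCoeff m i * expCoeff n j) •
      (C[[m + n - (i + j : ℕ)]]) ((D[[p + (i + j : ℕ)]]) v))
      (fun i j hij => by rw [hD _ (by omega), map_zero, smul_zero])]
    refine Finset.sum_congr rfl fun s _ => ?_
    rw [← expCoeff_vandermonde, Finset.sum_smul]
    refine Finset.sum_congr rfl fun q hq => ?_
    rw [Finset.HasAntidiagonal.mem_antidiagonal.1 hq]
  · rw [sum_square_eq_sum_antidiagonal N (fun i j => (expCoeff m i * expCoeff n j) •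
      (if m + n = (i + j : ℕ) then ((m - i : ℤ) : ℂ) * κ else 0) • (D[[p + (i + j : ℕ)]]) v)
      (fun i j hij => by rw [hD _ (by omega), smul_zero, smul_zero])]
    have e₂ : ∀ s ∈ Finset.range N, (∑ q ∈ Finset.HasAntidiagonal.antidiagonal s, (expCoeff m q.1 * expCoeff n q.2) •
        (if m + n = (q.1 + q.2 : ℕ) then ((m - q.1 : ℤ) : ℂ) * κ else 0) •
          (D[[p + (q.1 + q.2 : ℕ)]]) v) =
        if s = 0 then (if m + n = 0 then m * κ else 0) • (D[[p]]) v else 0 := by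
      intro s _
      by_cases hs : m + n = s
      · have := congrArg (fun z : ℤ => ((z : ℂ) * κ) • (D[[p + s]]) v)
          (expCoeff_vandermonde_central m n s hs)
        simp only [Int.cast_sum, Finset.sum_mul, Finset.sum_smul] at this
        rw [Finset.sum_congr rfl (g := fun q => (((expCoeff m q.1 * expCoeff n q.2 * (m - q.1) : ℤ) : ℂ)
          * κ) • (D[[p + s]]) v), this]
        · rcases s with _ | s
          · simp [hs]
          · simp
        · intro q hq
          rw [Finset.HasAntidiagonal.mem_antidiagonal.1 hq, if_pos hs, ← Int.cast_smul_eq_zsmul ℂ, smul_smul]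
          push_cast
          ring_nf
      · rw [Finset.sum_eq_zero]
        · split_ifs with h₁ h₂
          · exact absurd (by rw [h₁, h₂]; rfl) hs
          · rw [zero_smul]
          · rfl
        · intro q hq
          rw [Finset.HasAntidiagonal.mem_antidiagonal.1 hq, if_neg hs, zero_smul, smul_zero]
    rw [Finset.sum_congr rfl e₂, Finset.sum_ite_eq' (Finset.range N) 0, if_pos (by simp [hN])]

theorem rightRes_comm (h : AffineRel A B C κ) (m n : ℤ) (D : VertexOperator ℂ M) :
    rightRes A m (rightRes B n D) + rightRes C (m + n) D = rightRes B n (rightRes A m D) := by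
  refine ext_ncoeff fun p v => ?_
  obtain ⟨NA, hA⟩ := exists_nat_right A v
  obtain ⟨NB, hB⟩ := exists_nat_right B v
  obtain ⟨NC, hC⟩ := exists_nat_right C v
  choose KA hKA using fun i : ℕ => exists_nat_right A ((B[[(i : ℤ)]]) v)
  choose KB hKB using fun i : ℕ => exists_nat_right B ((A[[(i : ℤ)]]) v)
  set N := NA + NB + NC + ∑ i ∈ Finset.range NB, KA i + ∑ i ∈ Finset.range NA, KB i with hN
  have hA' : ∀ i : ℕ, N ≤ i → ∀ j : ℕ, (A[[(i : ℤ)]]) ((B[[(j : ℤ)]]) v) = 0 := by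
    intro i hi j
    rcases lt_or_ge j NB with hj | hj
    · have := Finset.single_le_sum (f := KA) (fun _ _ => Nat.zero_le _) (Finset.mem_range.2 hj)
      exact hKA j i (by omega)
    · rw [hB j hj, map_zero]
  have hB' : ∀ i : ℕ, N ≤ i → ∀ j : ℕ, (B[[(i : ℤ)]]) ((A[[(j : ℤ)]]) v) = 0 := by
    intro i hi j
    rcases lt_or_ge j NA with hj | hj
    · have := Finset.single_le_sum (f := KB) (fun _ _ => Nat.zero_le _) (Finset.mem_range.2 hj)
      exact hKB j i (by omega)
    · rw [hA j hj, map_zero]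
  have key : ∀ (X Z : VertexOperator ℂ M) (r t : ℤ),
      (∀ i : ℕ, N ≤ i → (X[[(i : ℤ)]]) v = 0) →
      (∀ i : ℕ, N ≤ i → ∀ j : ℕ, (Z[[(i : ℤ)]]) ((X[[(j : ℤ)]]) v) = 0) →
      ((rightRes X r (rightRes Z t D))[[p]]) v = (r + t).negOnePow •
      ∑ i ∈ Finset.range N, ∑ j ∈ Finset.range N, (expCoeff r i * expCoeff t j) •
        (D[[r + t + p - i - j]]) ((Z[[(j : ℤ)]]) ((X[[(i : ℤ)]]) v)) := by
    intro X Z r t hX hZ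
    rw [rightRes_apply X _ r p v hX, Int.negOnePow_add, mul_smul, Finset.smul_sum (r := t.negOnePow)]
    congr 1
    refine Finset.sum_congr rfl fun i _ => ?_
    rw [rightRes_apply Z D t _ _ (fun j hj => hZ j hj i), Units.smul_def, Units.smul_def, smul_comm,
      Finset.smul_sum (r := expCoeff r i)]
    congr 1
    refine Finset.sum_congr rfl fun j _ => ?_
    rw [mul_smul]
    congr 4
    ring_nf
  simp only [map_add, Pi.add_apply, LinearMap.add_apply]
  rw [key A B m n (fun i hi => hA i (by omega)) hB', key B A n m (fun i hi => hB i (by omega)) hA',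
    rightRes_apply C D (m + n) p v (N := N) (fun i hi => hC i (by omega)), add_comm n m, ← smul_add]
  congr 1
  rw [Finset.sum_comm (s := Finset.range N) (t := Finset.range N)
      (f := fun i j => (expCoeff n i * expCoeff m j) •
        (D[[m + n + p - i - j]]) ((A[[(j : ℤ)]]) ((B[[(i : ℤ)]]) v)))]
  have e₁ : ∀ i j : ℕ, (expCoeff n j * expCoeff m i) •
        (D[[m + n + p - j - i]]) ((A[[(i : ℤ)]]) ((B[[(j : ℤ)]]) v)) =
      (expCoeff m i * expCoeff n j) •
        (D[[m + n + p - i - j]]) ((B[[(j : ℤ)]]) ((A[[(i : ℤ)]]) v)) +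
      (expCoeff m i * expCoeff n j) •
        (D[[m + n + p - (i + j : ℕ)]]) ((C[[((i + j : ℕ) : ℤ)]]) v) := by
    intro i j
    have a₁ : m + n + p - i - j = m + n + p - (i + j : ℕ) := by push_cast; ring
    have a₂ : m + n + p - j - i = m + n + p - (i + j : ℕ) := by push_cast; ring
    have a₃ : (if (i : ℤ) + j = 0 then ((i : ℤ) : ℂ) * κ else 0) = 0 := by
      split_ifs with h0
      · have : (i : ℤ) = 0 := by omega
        simp [this]
      · rfl
    rw [h, a₃, zero_smul, add_zero, a₁, a₂, map_add, smul_add, mul_comm (expCoeff n j)]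
    push_cast
    rfl
  simp only [e₁, Finset.sum_add_distrib]
  congr 1
  rw [sum_square_eq_sum_antidiagonal N (fun i j => (expCoeff m i * expCoeff n j) •
      (D[[m + n + p - (i + j : ℕ)]]) ((C[[((i + j : ℕ) : ℤ)]]) v))
      (fun i j hij => by rw [hC _ (by omega), map_zero, smul_zero])]
  refine Finset.sum_congr rfl fun s _ => ?_
  rw [← expCoeff_vandermonde, Finset.sum_smul]
  refine Finset.sum_congr rfl fun q hq => ?_
  rw [Finset.HasAntidiagonal.mem_antidiagonal.1 hq]

/-- If `[A_m, B_n] = C_{m+n} + m κ δ_{m+n,0}`, then the operators of residue product with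
`A(x)` and `B(x)` satisfy the same relation. -/
theorem resProd_comm (h : AffineRel A B C κ) (m n : ℤ) :
    resProd A m * resProd B n = resProd B n * resProd A m + resProd C (m + n) +
      algebraMap ℂ _ (if m + n = 0 then m * κ else 0) := by
  refine LinearMap.ext fun D => ?_
  have h₁ := leftRes_comm h m n D
  have h₂ := rightRes_comm h m n D
  have h₃ := leftRes_rightRes_comm A B D m n
  have h₄ := leftRes_rightRes_comm B A D n m
  simp only [resProd, Module.End.mul_apply, LinearMap.add_apply, LinearMap.sub_apply, map_sub,
    Module.algebraMap_end_apply]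
  rw [h₁, h₃, h₄, ← h₂]
  abel

/-- For `m ≥ 0` the residue product with the identity field vanishes. -/
theorem resProd_idField (A : VertexOperator ℂ M) {m : ℤ} (hm : 0 ≤ m) :
    resProd A m idField = 0 := by
  lift m to ℕ using hm
  refine ext_ncoeff fun p v => ?_
  obtain ⟨N, hN⟩ := exists_nat_right A v
  have hid : ∀ (q : ℤ) (w : M), ((idField (M := M))[[q]]) w = if q = -1 then w else 0 := by
    intro q w
    rw [idField, ncoeff_ofModes]
    split_ifs <;> rfl
  have hc : ∀ i : ℕ, m < i → expCoeff m i = 0 := fun i hi => by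
    rw [expCoeff, Ring.choose_natCast, Nat.choose_eq_zero_of_lt hi]
    simp
  set K := N + m + p.natAbs + 2 with hK
  have hleft := leftRes_apply A idField m p v (N := K)
    (fun i hi => by rw [hid, if_neg (by omega)])
  have hright := rightRes_apply A idField m p v (N := K) (fun i hi => hN i (by omega))
  rw [resProd, LinearMap.sub_apply, map_sub, Pi.sub_apply, LinearMap.sub_apply, hleft, hright]
  simp only [hid, map_zero, Pi.zero_apply, LinearMap.zero_apply, sub_eq_zero]
  by_cases hp : 0 ≤ -1 - p ∧ -1 - p ≤ m
  · obtain ⟨s, hs⟩ := Int.eq_ofNat_of_zero_le hp.1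
    have hsm : s ≤ m := by omega
    rw [Finset.sum_eq_single s, Finset.sum_eq_single (m - s)]
    · rw [if_pos (by omega), if_pos (by omega), Nat.cast_sub hsm, Units.smul_def, smul_smul]
      congr 1
      rw [expCoeff, expCoeff, Ring.choose_natCast, Ring.choose_natCast, Nat.choose_symm hsm,
        ← mul_assoc]
      congr 1
      rw [Int.negOnePow_def]
      rw [zpow_natCast]
      obtain ⟨t, rfl⟩ := Nat.exists_eq_add_of_le hsm
      push_cast
      rw [Nat.add_sub_cancel_left, pow_add, mul_assoc, ← mul_pow]
      simp
    · intro i _ hi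
      rw [if_neg (by omega), smul_zero]
    · intro h
      exact absurd (Finset.mem_range.2 (by omega)) h
    · intro i _ hi
      rw [if_neg (by omega), map_zero, smul_zero]
    · intro h
      exact absurd (Finset.mem_range.2 (by omega)) h
  · rw [Finset.sum_eq_zero, Finset.sum_eq_zero, smul_zero]
    · intro i _
      rcases lt_or_ge m i with hi | hi
      · rw [hc i hi, zero_smul]
      · rw [if_neg (by omega), smul_zero]
    · intro i _
      rcases lt_or_ge m i with hi | hi
      · rw [hc i hi, zero_smul]
      · rw [if_neg (by omega), map_zero, smul_zero]

end VertexOperator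

/-! ## The affine Lie algebra of type `A₁⁽¹⁾` and its highest weight modules -/

namespace AffineSl2

open VertexOperator

/-- The Lie algebra `sl₂` of traceless complex `2 × 2` matrices. -/
abbrev Sl2 : Type := LieAlgebra.SpecialLinear.sl (Fin 2) ℂ

/-- The Chevalley basis element `h`. -/
def h : Sl2 := LieAlgebra.SpecialLinear.singleSubSingle 0 1 1

/-- The Chevalley basis element `e`. -/
def e : Sl2 := LieAlgebra.SpecialLinear.single 0 1 (by decide) 1

/-- The Chevalley basis element `f`. -/
def f : Sl2 := LieAlgebra.SpecialLinear.single 1 0 (by decide) 1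

/-- The normalized Killing form of `sl₂`: the trace form, with `⟨h, h⟩ = 2`, `⟨e, f⟩ = 1`. -/
def killing (a b : Sl2) : ℂ := (a.val * b.val).trace

/-- The defining relations of the level `k` enveloping algebra of the affine Lie algebra
`sl₂ ⊗ ℂ[t, t⁻¹] ⊕ ℂ C`, in which the generator `(a, n)` stands for `a ⊗ t ^ n` and the central
element `C` is set equal to `k`: linearity in `a`, and
`[a(m), b(n)] = [a, b](m + n) + m ⟨a, b⟩ δ_{m+n,0} k`. -/
inductive Rel (k : ℂ) : FreeAlgebra ℂ (Sl2 × ℤ) → FreeAlgebra ℂ (Sl2 × ℤ) → Prop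
  | add (a b : Sl2) (n : ℤ) : Rel k (FreeAlgebra.ι ℂ (a + b, n))
      (FreeAlgebra.ι ℂ (a, n) + FreeAlgebra.ι ℂ (b, n))
  | smul (c : ℂ) (a : Sl2) (n : ℤ) : Rel k (FreeAlgebra.ι ℂ (c • a, n))
      (c • FreeAlgebra.ι ℂ (a, n))
  | comm (a b : Sl2) (m n : ℤ) : Rel k (FreeAlgebra.ι ℂ (a, m) * FreeAlgebra.ι ℂ (b, n))
      (FreeAlgebra.ι ℂ (b, n) * FreeAlgebra.ι ℂ (a, m) + FreeAlgebra.ι ℂ (⁅a, b⁆, m + n) +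
        algebraMap ℂ _ (if m + n = 0 then m * (killing a b * k) else 0))

/-- The quotient of the universal enveloping algebra of the affine Lie algebra of type `A₁⁽¹⁾` by
the relation `C = k`. Its modules are the modules of level `k` for the affine Lie algebra. -/
def Env (k : ℂ) : Type := RingQuot (Rel k)

instance (k : ℂ) : Ring (Env k) := inferInstanceAs (Ring (RingQuot (Rel k)))
instance (k : ℂ) : Algebra ℂ (Env k) := inferInstanceAs (Algebra ℂ (RingQuot (Rel k)))

/-- The quotient map from the free algebra. -/
def envMk (k : ℂ) : FreeAlgebra ℂ (Sl2 × ℤ) →ₐ[ℂ] Env k := RingQuot.mkAlgHom ℂ (Rel k)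

theorem envMk_surjective (k : ℂ) : Function.Surjective (envMk k) :=
  RingQuot.mkAlgHom_surjective ℂ (Rel k)

theorem envMk_rel {k : ℂ} {x y : FreeAlgebra ℂ (Sl2 × ℤ)} (h : Rel k x y) : envMk k x = envMk k y :=
  RingQuot.mkAlgHom_rel ℂ h

/-- The element `a(n) = a ⊗ t ^ n`. -/
def gen (k : ℂ) (a : Sl2) (n : ℤ) : Env k := envMk k (FreeAlgebra.ι ℂ (a, n))

variable {k : ℂ}

theorem gen_comm (a b : Sl2) (m n : ℤ) : gen k a m * gen k b n =
    gen k b n * gen k a m + gen k ⁅a, b⁆ (m + n) +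
      algebraMap ℂ _ (if m + n = 0 then m * (killing a b * k) else 0) := by
  have := envMk_rel (Rel.comm (k := k) a b m n)
  simp only [map_mul, map_add, AlgHom.commutes] at this
  exact this

theorem gen_add (a b : Sl2) (n : ℤ) : gen k (a + b) n = gen k a n + gen k b n := by
  have := envMk_rel (Rel.add (k := k) a b n)
  simp only [map_add] at this
  exact this

theorem gen_smul (c : ℂ) (a : Sl2) (n : ℤ) : gen k (c • a) n = c • gen k a n := by
  have := envMk_rel (Rel.smul (k := k) c a n)
  simp only [map_smul] at this
  exact this

theorem env_induction {P : Env k → Prop} (algebraMap : ∀ c, P (algebraMap ℂ _ c))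
    (gen : ∀ a n, P (gen k a n)) (mul : ∀ x y, P x → P y → P (x * y))
    (add : ∀ x y, P x → P y → P (x + y)) (x : Env k) : P x := by
  obtain ⟨y, rfl⟩ := envMk_surjective k x
  induction y using FreeAlgebra.induction with
  | grade0 c => rw [AlgHom.commutes]; exact algebraMap c
  | grade1 p => exact gen p.1 p.2
  | mul x y hx hy => rw [map_mul]; exact mul _ _ hx hy
  | add x y hx hy => rw [map_add]; exact add _ _ hx hy

/-- The submodule of relations of the Verma module of level `k` and highest weight `lam`:
generated by `a(n)` for `n ≥ 1`, by `e(0)` and by `h(0) - lam`. -/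
def vermaRel (k lam : ℂ) : Submodule (Env k) (Env k) :=
  Submodule.span (Env k)
    ({x | ∃ (a : Sl2) (n : ℤ), 1 ≤ n ∧ x = gen k a n} ∪
      {gen k e 0, gen k h 0 - algebraMap ℂ _ lam})

/-- The Verma module of level `k` and highest weight `lam`. -/
def Verma (k lam : ℂ) : Type := Env k ⧸ vermaRel k lam

instance (k lam : ℂ) : AddCommGroup (Verma k lam) := inferInstanceAs (AddCommGroup (Env k ⧸ vermaRel k lam))
instance (k lam : ℂ) : Module (Env k) (Verma k lam) := inferInstanceAs (Module (Env k) (Env k ⧸ vermaRel k lam))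
instance (k lam : ℂ) : Module ℂ (Verma k lam) := inferInstanceAs (Module ℂ (Env k ⧸ vermaRel k lam))
instance (k lam : ℂ) : IsScalarTower ℂ (Env k) (Verma k lam) :=
  inferInstanceAs (IsScalarTower ℂ (Env k) (Env k ⧸ vermaRel k lam))

/-- The maximal proper submodule of the Verma module: the sum of all its proper submodules. -/
def maxSubmodule (k lam : ℂ) : Submodule (Env k) (Verma k lam) := sSup {N | N ≠ ⊤}

/-- `L(k, lam)`: the irreducible highest weight module of level `k` and highest weight `lam`. -/
def Irr (k lam : ℂ) : Type := Verma k lam ⧸ maxSubmodule k lam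

instance (k lam : ℂ) : AddCommGroup (Irr k lam) := inferInstanceAs (AddCommGroup (Verma k lam ⧸ maxSubmodule k lam))
instance (k lam : ℂ) : Module (Env k) (Irr k lam) := inferInstanceAs (Module (Env k) (Verma k lam ⧸ maxSubmodule k lam))
instance (k lam : ℂ) : Module ℂ (Irr k lam) := inferInstanceAs (Module ℂ (Verma k lam ⧸ maxSubmodule k lam))
instance (k lam : ℂ) : IsScalarTower ℂ (Env k) (Irr k lam) :=
  inferInstanceAs (IsScalarTower ℂ (Env k) (Verma k lam ⧸ maxSubmodule k lam))

/-- The quotient map onto the Verma module. -/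
def vermaMk (k lam : ℂ) : Env k →ₗ[Env k] Verma k lam := (vermaRel k lam).mkQ

/-- The quotient map onto `L(k, lam)`. -/
def irrMk (k lam : ℂ) : Env k →ₗ[Env k] Irr k lam :=
  (maxSubmodule k lam).mkQ.comp (vermaMk k lam)

theorem irrMk_surjective (k lam : ℂ) : Function.Surjective (irrMk k lam) :=
  (Submodule.mkQ_surjective _).comp (Submodule.mkQ_surjective _)

theorem irrMk_eq_zero {k lam : ℂ} {x : Env k} (hx : x ∈ vermaRel k lam) : irrMk k lam x = 0 := by
  have h : vermaMk k lam x = 0 := (Submodule.Quotient.mk_eq_zero _).2 hx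
  have : (maxSubmodule k lam).mkQ (vermaMk k lam x) = 0 := by rw [h, map_zero]
  exact this

/-- The canonical highest weight vector of `L(k, lam)`. -/
def hwVec (k lam : ℂ) : Irr k lam := irrMk k lam 1

/-- The top level vector `v^{i,j} = f(0) ^ j v^i / j!` of `L(k, i)`, where `v^i` is the highest
weight vector. -/
def topVec (k : ℂ) (i j : ℕ) : Irr k i := (j.factorial : ℂ)⁻¹ • (gen k f 0 ^ j • hwVec k i)

/-- The submodule of relations of the Weyl module `V(k, 0)`, generated by `a(n)` for `n ≥ 0`. -/
def weylRel (k : ℂ) : Submodule (Env k) (Env k) :=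
  Submodule.span (Env k) {x | ∃ (a : Sl2) (n : ℤ), 0 ≤ n ∧ x = gen k a n}

/-- The Weyl module `V(k, 0)`: the module of level `k` induced from the trivial module of
`sl₂ ⊗ ℂ[t]`. -/
def Weyl (k : ℂ) : Type := Env k ⧸ weylRel k

instance (k : ℂ) : AddCommGroup (Weyl k) := inferInstanceAs (AddCommGroup (Env k ⧸ weylRel k))
instance (k : ℂ) : Module (Env k) (Weyl k) := inferInstanceAs (Module (Env k) (Env k ⧸ weylRel k))
instance (k : ℂ) : Module ℂ (Weyl k) := inferInstanceAs (Module ℂ (Env k ⧸ weylRel k))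
instance (k : ℂ) : IsScalarTower ℂ (Env k) (Weyl k) :=
  inferInstanceAs (IsScalarTower ℂ (Env k) (Env k ⧸ weylRel k))

/-- The quotient map onto the Weyl module. -/
def weylMk (k : ℂ) : Env k →ₗ[Env k] Weyl k := (weylRel k).mkQ

theorem weylMk_surjective (k : ℂ) : Function.Surjective (weylMk k) :=
  Submodule.mkQ_surjective _

/-- The vacuum vector. -/
def vac (k : ℂ) : Weyl k := weylMk k 1

/-! ### Vertex operators -/

section Smooth

variable (k) (M : Type*) [AddCommGroup M] [Module (Env k) M]

/-- A module of level `k` is smooth if for all `a` and `v`, `a(n) v = 0` for `n` large. -/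
class IsSmooth : Prop where
  exists_bound : ∀ (a : Sl2) (v : M), ∃ N : ℤ, ∀ n, N ≤ n → gen k a n • v = 0

variable {M}

/-- A module of level `k` generated by a vector annihilated by all `a(n)`, `n ≥ 1`, is smooth. -/
theorem isSmooth_of_cyclic (w : M) (hw : ∀ (a : Sl2) (n : ℤ), 1 ≤ n → gen k a n • w = 0)
    (hgen : ∀ v : M, ∃ x : Env k, v = x • w) : IsSmooth k M := by
  have key : ∀ (x : Env k) (v : M),
      (∀ a : Sl2, ∃ N : ℤ, ∀ n, N ≤ n → gen k a n • v = 0) →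
      ∀ a : Sl2, ∃ N : ℤ, ∀ n, N ≤ n → gen k a n • x • v = 0 := by
    intro x
    induction x using env_induction with
    | algebraMap c =>
      intro v hv a
      obtain ⟨N, hN⟩ := hv a
      refine ⟨N, fun n hn => ?_⟩
      rw [smul_smul, ← Algebra.commutes, ← smul_smul, hN n hn, smul_zero]
    | gen b m =>
      intro v hv a
      obtain ⟨N₁, h₁⟩ := hv a
      obtain ⟨N₂, h₂⟩ := hv ⁅a, b⁆
      refine ⟨max (max N₁ (N₂ - m)) (1 - m), fun n hn => ?_⟩
      rw [smul_smul, gen_comm, add_smul, add_smul, ← smul_smul, h₁ n (by omega), smul_zero,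
        h₂ _ (by omega), if_neg (by omega), map_zero, zero_smul, add_zero, add_zero]
    | mul x y hx hy =>
      intro v hv a
      simpa only [smul_smul] using hx (y • v) (hy v hv) a
    | add x y hx hy =>
      intro v hv a
      obtain ⟨N₁, h₁⟩ := hx v hv a
      obtain ⟨N₂, h₂⟩ := hy v hv a
      refine ⟨max N₁ N₂, fun n hn => ?_⟩
      rw [add_smul, smul_add, h₁ n (by omega), h₂ n (by omega), add_zero]
  refine ⟨fun a v => ?_⟩
  obtain ⟨x, rfl⟩ := hgen v
  exact key x w (fun b => ⟨1, fun n hn => hw b n hn⟩) a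

end Smooth

instance (k lam : ℂ) : IsSmooth k (Irr k lam) := by
  refine isSmooth_of_cyclic k (hwVec k lam) (fun a n hn => ?_) (fun v => ?_)
  · rw [hwVec, ← map_smul, smul_eq_mul, mul_one]
    exact irrMk_eq_zero (Submodule.subset_span (Or.inl ⟨a, n, hn, rfl⟩))
  · obtain ⟨x, rfl⟩ := irrMk_surjective k lam v
    exact ⟨x, by rw [hwVec, ← map_smul, smul_eq_mul, mul_one]⟩

section Fields

variable (k) (M : Type*) [AddCommGroup M] [Module ℂ M] [Module (Env k) M]
  [IsScalarTower ℂ (Env k) M] [IsSmooth k M]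

/-- The field `a(x) = ∑ a(n) x ^ (-n - 1)` on a smooth module of level `k`. -/
def current (a : Sl2) : VertexOperator ℂ M :=
  ofModes (fun n => Algebra.lsmul ℂ ℂ M (gen k a n)) fun v => by
    obtain ⟨N, hN⟩ := IsSmooth.exists_bound (k := k) a v
    exact ⟨N, fun n hn => hN n hn⟩

theorem current_apply (a : Sl2) (n : ℤ) (v : M) : ((current k M a)[[n]]) v = gen k a n • v := by
  rw [current, ncoeff_ofModes]
  rfl

theorem affineRel_current (a b : Sl2) : AffineRel (current k M a) (current k M b)
    (current k M ⁅a, b⁆) (killing a b * k) := by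
  intro m n v
  simp only [current_apply]
  rw [smul_smul, gen_comm, add_smul, add_smul, smul_smul, algebraMap_smul]

theorem fieldAction_rel ⦃x y : FreeAlgebra ℂ (Sl2 × ℤ)⦄ (hxy : Rel k x y) :
    FreeAlgebra.lift ℂ (fun p : Sl2 × ℤ => resProd (current k M p.1) p.2) x =
      FreeAlgebra.lift ℂ (fun p : Sl2 × ℤ => resProd (current k M p.1) p.2) y := by
  induction hxy with
  | add a b n =>
    simp only [FreeAlgebra.lift_ι_apply, map_add]
    rw [← resProd_add]
    congr 1
    refine ext_ncoeff fun m v => ?_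
    simp only [map_add, Pi.add_apply, LinearMap.add_apply, current_apply, gen_add, add_smul]
  | smul c a n =>
    simp only [FreeAlgebra.lift_ι_apply, map_smul]
    rw [← resProd_smul]
    congr 1
    refine ext_ncoeff fun m v => ?_
    simp only [map_smul, Pi.smul_apply, LinearMap.smul_apply, current_apply, gen_smul,
      smul_assoc]
  | comm a b m n =>
    simp only [FreeAlgebra.lift_ι_apply, map_add, map_mul, AlgHom.commutes]
    exact resProd_comm (affineRel_current k M a b) m n

/-- The action of the level `k` enveloping algebra on the space of vertex operators of `M` in which
`a(n)` acts by the residue product `a(x)_n`. -/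
def fieldAction : Env k →ₐ[ℂ] Module.End ℂ (VertexOperator ℂ M) :=
  RingQuot.liftAlgHom ℂ
    ⟨FreeAlgebra.lift ℂ fun p => resProd (current k M p.1) p.2, fieldAction_rel k M⟩

theorem fieldAction_gen (a : Sl2) (n : ℤ) :
    fieldAction k M (gen k a n) = resProd (current k M a) n := by
  have := RingQuot.liftAlgHom_mkAlgHom_apply (S := ℂ)
    (FreeAlgebra.lift ℂ fun p : Sl2 × ℤ => resProd (current k M p.1) p.2)
    (fieldAction_rel k M) (FreeAlgebra.ι ℂ (a, n))
  rw [FreeAlgebra.lift_ι_apply] at this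
  exact this

/-- The vertex operator map `Y(·, x)` of a smooth module of level `k`, viewed as a module for the
vertex operator algebra `V(k, 0)`:
`Y(a¹(n₁) ⋯ aʳ(nᵣ) 𝟙, x) = a¹(x)_{n₁} ⋯ aʳ(x)_{nᵣ} 1`, where `1` is the identity field. -/
def Y : Weyl k →ₗ[ℂ] VertexOperator ℂ M :=
  ((weylRel k).restrictScalars ℂ).liftQ
    ((LinearMap.applyₗ idField).comp (fieldAction k M).toLinearMap) (by
      intro x hx
      simp only [Submodule.restrictScalars_mem, weylRel] at hx
      simp only [LinearMap.mem_ker, LinearMap.comp_apply, AlgHom.toLinearMap_apply,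
        LinearMap.applyₗ_apply_apply]
      induction hx using Submodule.span_induction with
      | mem x hx =>
        obtain ⟨a, n, hn, rfl⟩ := hx
        rw [fieldAction_gen, resProd_idField _ hn]
      | zero => rw [map_zero, LinearMap.zero_apply]
      | add x y _ _ hx hy => rw [map_add, LinearMap.add_apply, hx, hy, add_zero]
      | smul c x _ hx => rw [smul_eq_mul, map_mul, Module.End.mul_apply, hx, map_zero])

theorem Y_weylMk (x : Env k) : Y k M (weylMk k x) = fieldAction k M x idField := rfl

theorem Y_vac : Y k M (vac k) = idField := by
  rw [vac, Y_weylMk, map_one, Module.End.one_apply]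

theorem Y_gen_smul (a : Sl2) (n : ℤ) (u : Weyl k) :
    Y k M (gen k a n • u) = resProd (current k M a) n (Y k M u) := by
  obtain ⟨x, rfl⟩ := weylMk_surjective k u
  rw [← map_smul, Y_weylMk, Y_weylMk, smul_eq_mul, map_mul, fieldAction_gen, Module.End.mul_apply]

end Fields

/-! ### The vectors `ω`, `W³`, `W⁴`, `W⁵` and the zero modes -/

/-- The vector `a¹(n₁) ⋯ aʳ(nᵣ) 𝟙` of `V(k, 0)`. -/
def word (k : ℂ) : List (Sl2 × ℤ) → Weyl k
  | [] => vac k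
  | (a, n) :: l => gen k a n • word k l

/-- The component operator `u_n`, the coefficient of `x ^ (-n - 1)` in `Y(u, x)`, on a smooth module
of level `k`. -/
def component {k : ℂ} (u : Weyl k) (n : ℤ) (M : Type*) [AddCommGroup M] [Module ℂ M]
    [Module (Env k) M] [IsScalarTower ℂ (Env k) M] [IsSmooth k M] : Module.End ℂ M :=
  (Y k M u)[[n]]

/-- The conformal vector `ω = ω_aff - ω_γ` of the commutant of the Heisenberg algebra. -/
def omegaVec (k : ℂ) : Weyl k :=
  (1 / (2 * k * (k + 2))) • (-k • word k [(h, -2)] - word k [(h, -1), (h, -1)]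
    + (2 * k) • word k [(e, -1), (f, -1)])

/-- The Virasoro primary vector `W³` of weight `3`. -/
def W3 (k : ℂ) : Weyl k :=
  (k ^ 2) • word k [(h, -3)]
    + (3 * k) • word k [(h, -2), (h, -1)]
    + (2 : ℂ) • word k [(h, -1), (h, -1), (h, -1)]
    - (6 * k) • word k [(h, -1), (e, -1), (f, -1)]
    + (3 * k ^ 2) • word k [(e, -2), (f, -1)]
    - (3 * k ^ 2) • word k [(e, -1), (f, -2)]

/-- The Virasoro primary vector `W⁴` of weight `4`. -/
def W4 (k : ℂ) : Weyl k :=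
  -(2 * k ^ 2 * (k ^ 2 + k + 1)) • word k [(h, -4)]
    - (8 * k * (k ^ 2 + k + 1)) • word k [(h, -3), (h, -1)]
    - (k * (5 * k ^ 2 - 6)) • word k [(h, -2), (h, -2)]
    - (2 * k * (11 * k + 6)) • word k [(h, -2), (h, -1), (h, -1)]
    - (11 * k + 6) • word k [(h, -1), (h, -1), (h, -1), (h, -1)]
    + (4 * k ^ 2 * (6 * k - 5)) • word k [(h, -2), (e, -1), (f, -1)]
    + (4 * k * (11 * k + 6)) • word k [(h, -1), (h, -1), (e, -1), (f, -1)]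
    - (4 * k ^ 2 * (5 * k + 11)) • word k [(h, -1), (e, -2), (f, -1)]
    + (4 * k ^ 2 * (5 * k + 11)) • word k [(h, -1), (e, -1), (f, -2)]
    + (8 * k ^ 2 * (k - 3) * (k - 2)) • word k [(e, -3), (f, -1)]
    - (4 * k ^ 2 * (3 * k ^ 2 - 3 * k + 8)) • word k [(e, -2), (f, -2)]
    - (2 * k ^ 2 * (6 * k - 5)) • word k [(e, -1), (e, -1), (f, -1), (f, -1)]
    + (8 * k ^ 2 * (k ^ 2 + k + 1)) • word k [(e, -1), (f, -3)]

/-- The Virasoro primary vector `W⁵` of weight `5`. -/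
def W5 (k : ℂ) : Weyl k :=
  -(2 * k ^ 3 * (k ^ 2 + 3 * k + 5)) • word k [(h, -5)]
    - (10 * k ^ 2 * (k ^ 2 + 3 * k + 5)) • word k [(h, -4), (h, -1)]
    - (5 * k ^ 2 * (3 * k ^ 2 - 4)) • word k [(h, -3), (h, -2)]
    - (5 * k * (7 * k ^ 2 + 12 * k + 16)) • word k [(h, -3), (h, -1), (h, -1)]
    - (15 * k * (3 * k ^ 2 - 4)) • word k [(h, -2), (h, -2), (h, -1)]
    - (5 * k * (19 * k + 12)) • word k [(h, -2), (h, -1), (h, -1), (h, -1)]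
    - (2 * (19 * k + 12)) • word k [(h, -1), (h, -1), (h, -1), (h, -1), (h, -1)]
    + (10 * k ^ 2 * (4 * k ^ 2 - 7 * k + 8)) • word k [(h, -3), (e, -1), (f, -1)]
    + (20 * k ^ 2 * (10 * k - 7)) • word k [(h, -2), (h, -1), (e, -1), (f, -1)]
    + (10 * k * (19 * k + 12)) • word k [(h, -1), (h, -1), (h, -1), (e, -1), (f, -1)]
    - (5 * k ^ 2 * (11 * k ^ 2 - 14 * k + 12)) • word k [(h, -2), (e, -2), (f, -1)]
    - (5 * k ^ 2 * (17 * k + 64)) • word k [(h, -1), (h, -1), (e, -2), (f, -1)]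
    + (15 * k ^ 2 * (3 * k ^ 2 - 4)) • word k [(h, -2), (e, -1), (f, -2)]
    + (5 * k ^ 2 * (17 * k + 64)) • word k [(h, -1), (h, -1), (e, -1), (f, -2)]
    + (30 * k ^ 2 * (k - 4) * (k - 3)) • word k [(h, -1), (e, -3), (f, -1)]
    - (40 * k ^ 2 * (k ^ 2 + 3 * k + 5)) • word k [(h, -1), (e, -2), (f, -2)]
    - (10 * k ^ 2 * (10 * k - 7)) • word k [(h, -1), (e, -1), (e, -1), (f, -1), (f, -1)]
    + (10 * k ^ 2 * (3 * k ^ 2 + 19 * k + 8)) • word k [(h, -1), (e, -1), (f, -3)]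
    - (10 * k ^ 3 * (k - 4) * (k - 3)) • word k [(e, -4), (f, -1)]
    + (20 * k ^ 3 * (k - 4) * (k - 3)) • word k [(e, -3), (f, -2)]
    + (5 * k ^ 3 * (10 * k - 7)) • word k [(e, -2), (e, -1), (f, -1), (f, -1)]
    - (10 * k ^ 3 * (2 * k ^ 2 - 4 * k + 17)) • word k [(e, -2), (f, -3)]
    - (5 * k ^ 3 * (10 * k - 7)) • word k [(e, -1), (e, -1), (f, -2), (f, -1)]
    + (10 * k ^ 3 * (k ^ 2 + 3 * k + 5)) • word k [(e, -1), (f, -4)]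

end AffineSl2

end

/-! On vectors killed by every positive mode, the zero mode of a state a¹(n₁)⋯aʳ(nᵣ)𝟙 with all nᵢ
negative has a closed form, so no normally ordered product has to be expanded. Take n ≤ -1 and split
the residue a(x)_n B(x), B = Y(u, x), into its two halves. Where B acts first, at the zero mode
index of a(n)u or above, only modes of B occur that are too high and annihilate the vector
(`component_word_eq_zero`). Where a acts first, only its nonnegative modes occur, and of these only
a(0) survives. Hence the zero mode of a(n)u on v is (-1)^(n+1) times the zero mode of u on a(0)v
(`resProd_current_apply_of_isTop`). Since a(0)v is again killed by all positive modes
(`IsTop.gen_zero_smul`), induction on the word yields ± aʳ(0)⋯a¹(0), with the order of the letters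
reversed (`component_word`).

What remains is sl₂ theory for the string v^{i,j}. In every word of ω, W³, W⁴, W⁵ the letters h
precede the letters e, which precede the letters f, and e and f occur equally often, at most twice.
After the reversal the h(0) act first, as the scalar i - 2j, and the rest is f(0)e(0) or f(0)²e(0)²,
whose eigenvalues are `f_smul_e_smul_topVec` and `f_sq_smul_e_sq_smul_topVec`. Words that differ
only in their mode numbers act equally up to sign; collecting their coefficients gives the stated
polynomials. -/

namespace AffineSl2

open VertexOperator

/-! ### Zero modes on vectors killed by the positive modes. -/

section TopVectors

variable {k : ℂ} {M : Type*} [AddCommGroup M] [Module ℂ M] [Module (Env k) M]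
  [IsScalarTower ℂ (Env k) M]

/-- The vectors annihilated by all positive modes. -/
def IsTop (k : ℂ) {M : Type*} [AddCommGroup M] [Module (Env k) M] (v : M) : Prop :=
  ∀ (a : Sl2) (n : ℤ), 1 ≤ n → gen k a n • v = 0

theorem gen_smul_smul (a : Sl2) (n : ℤ) (c : ℂ) (v : M) :
    gen k a n • c • v = c • gen k a n • v := by
  rw [← algebraMap_smul (Env k) c v, ← algebraMap_smul (Env k) c (gen k a n • v), smul_smul,
    smul_smul, Algebra.commutes]

theorem gen_smul_gen_smul (a b : Sl2) (m n : ℤ) (v : M) :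
    gen k a m • gen k b n • v = gen k b n • gen k a m • v + gen k ⁅a, b⁆ (m + n) • v +
      (if m + n = 0 then m * (killing a b * k) else 0) • v := by
  rw [smul_smul, gen_comm, add_smul, add_smul, smul_smul, algebraMap_smul]

theorem IsTop.smul {v : M} (hv : IsTop k v) (c : ℂ) : IsTop k (c • v) := fun a n hn => by
  rw [gen_smul_smul, hv a n hn, smul_zero]

/-- The commutator of a(n) with b(0) is [a, b](n), again a positive mode, and for n ≥ 1 there is no
central term. This closure lets the recursion on words replace v by a(0)v. -/
theorem IsTop.gen_zero_smul {v : M} (hv : IsTop k v) (b : Sl2) : IsTop k (gen k b 0 • v) :=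
  fun a n hn => by
    rw [gen_smul_gen_smul, hv a n hn, add_zero, hv _ n hn, if_neg (by omega), zero_smul,
      smul_zero, add_zero, add_zero]

/-- The operator `± aʳ(0) ⋯ a¹(0)` by which the zero mode of `a¹(n₁) ⋯ aʳ(nᵣ) 𝟙` acts on vectors
annihilated by all positive modes. -/
def revAct (k : ℂ) {M : Type*} [AddCommGroup M] [Module ℂ M] [Module (Env k) M] :
    List (Sl2 × ℤ) → M → M
  | [], v => v
  | (a, n) :: l, v => ((-1 : ℂ) ^ (n + 1).natAbs) • revAct k l (gen k a 0 • v)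

/-- The conformal weight of `a¹(n₁) ⋯ aʳ(nᵣ) 𝟙`. -/
def wordWeight : List (Sl2 × ℤ) → ℤ
  | [] => 0
  | (_, n) :: l => -n + wordWeight l

variable [IsSmooth k M]

/-- The recursion step for words. If B is the field of a state of weight w, then w - n - 1 is the
zero mode index of the state with a(n) prepended, so the bound on p admits that zero mode and every
higher mode. The vanishing of B is needed on all vectors of this kind, not just on v, so that the
lemma can be iterated along a word. -/
theorem resProd_current_apply_of_isTop (a : Sl2) (B : VertexOperator ℂ M) {n p w : ℤ}
    (hn : n ≤ -1) (hB : ∀ (v : M) (q : ℤ), IsTop k v → w ≤ q → (B[[q]]) v = 0)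
    (hp : w - n - 1 ≤ p) {v : M} (hv : IsTop k v) :
    ((resProd (current k M a) n B)[[p]]) v =
      ((-1 : ℂ) ^ (n + 1).natAbs) • (B[[n + p]]) (gen k a 0 • v) := by
  rw [resProd, LinearMap.sub_apply, map_sub, Pi.sub_apply, LinearMap.sub_apply,
    -- As n ≤ -1, the bound on p gives p ≥ w, so every mode of B in this half kills v and the sum is
    -- empty.
    leftRes_apply _ _ _ _ _ (N := 0) (fun i _ => hB v _ hv (by omega)),
    -- The modes a(i) with i ≥ 1 kill v, so only the term i = 0 is left.
    rightRes_apply _ _ _ _ _ (N := 1) (fun i hi => by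
      rw [current_apply]; exact hv a i (by omega))]
  -- With n = -m - 1 the sign (-1)^n of the expansion is -(-1)^m; its minus cancels the one in front
  -- of this half of the residue product.
  obtain ⟨m, rfl⟩ : ∃ m : ℕ, n = -(m : ℤ) - 1 := ⟨(-n - 1).toNat, by omega⟩
  have h₁ : (-(m : ℤ) - 1 + 1).natAbs = m := by omega
  have h₂ : (-(m : ℤ) - 1).negOnePow = -(-1) ^ m := by
    rw [Int.negOnePow_sub, Int.negOnePow_neg, Int.negOnePow_one, Int.negOnePow_def, zpow_natCast]
    simp
  rw [h₁, h₂]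
  simp only [Finset.sum_range_zero, Finset.sum_range_one, expCoeff_zero, one_smul, Nat.cast_zero,
    sub_zero, current_apply, zero_sub, Units.smul_def, Units.val_neg, neg_smul, neg_neg,
    Units.val_pow_eq_pow_val, Units.val_one]
  rw [← Int.cast_smul_eq_zsmul ℂ]
  push_cast
  rfl

/-- Modes above the zero mode lower the degree, and v sits in lowest degree. The induction moves
each letter onto v as a(0); this lowers the mode index and the weight of the word by the same amount
-n, so the inequality persists. -/
theorem component_word_eq_zero {l : List (Sl2 × ℤ)} (hl : ∀ p ∈ l, p.2 ≤ -1) (v : M) (q : ℤ)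
    (hv : IsTop k v) (hq : wordWeight l ≤ q) : (component (word k l) q M) v = 0 := by
  induction l generalizing v q with
  | nil =>
    rw [component, word, Y_vac, idField, ncoeff_ofModes]
    rw [wordWeight] at hq
    -- The empty word has weight 0, and the identity field has only the mode -1.
    rw [if_neg (by omega)]
    rfl
  | cons x l ih =>
    obtain ⟨a, n⟩ := x
    have hn : n ≤ -1 := hl (a, n) (by simp)
    have ih' := ih fun p hp => hl p (List.mem_cons_of_mem _ hp)
    rw [wordWeight] at hq
    rw [component, word, Y_gen_smul, resProd_current_apply_of_isTop a _ hn ih' (by omega) hv]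
    have := ih' (gen k a 0 • v) (n + q) (hv.gen_zero_smul a) (by omega)
    rw [component] at this
    rw [this, smul_zero]

/-- The zero mode of `a¹(n₁) ⋯ aʳ(nᵣ) 𝟙`, with all `nᵢ` negative, acts on a vector annihilated by
all positive modes by `± aʳ(0) ⋯ a¹(0)`. -/
theorem component_word {v : M} (hv : IsTop k v) {l : List (Sl2 × ℤ)} (hl : ∀ p ∈ l, p.2 ≤ -1)
    {q : ℤ} (hq : q = wordWeight l - 1) :
    (component (word k l) q M) v = revAct k l v := by
  induction l generalizing v q with
  | nil =>
    -- Weight 0 makes the zero mode index -1, where the identity field is the identity operator.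
    rw [component, word, Y_vac, idField, ncoeff_ofModes, hq, wordWeight, if_pos (by norm_num)]
    rfl
  | cons x l ih =>
    obtain ⟨a, n⟩ := x
    have hn : n ≤ -1 := hl (a, n) (by simp)
    have hl' : ∀ p ∈ l, p.2 ≤ -1 := fun p hp => hl p (List.mem_cons_of_mem _ hp)
    rw [wordWeight] at hq
    rw [component, word, Y_gen_smul,
      resProd_current_apply_of_isTop a _ hn (component_word_eq_zero hl') (by omega) hv, revAct,
      -- Since q = -n + `wordWeight l` - 1, the index n + q is exactly the zero mode index of the
      -- tail.
      ← ih (hv.gen_zero_smul a) hl' (q := n + q) (by omega)]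
    rfl

theorem component_add (u u' : Weyl k) (n : ℤ) (v : M) :
    component (u + u') n M v = component u n M v + component u' n M v := by
  simp only [component, map_add, Pi.add_apply, LinearMap.add_apply]

theorem component_sub (u u' : Weyl k) (n : ℤ) (v : M) :
    component (u - u') n M v = component u n M v - component u' n M v := by
  simp only [component, map_sub, Pi.sub_apply, LinearMap.sub_apply]

theorem component_smul (c : ℂ) (u : Weyl k) (n : ℤ) (v : M) :
    component (c • u) n M v = c • component u n M v := by
  simp only [component, map_smul, Pi.smul_apply, LinearMap.smul_apply]

end TopVectors

/-! ### The sl₂-string of top level vectors. -/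

theorem lie_e_f : ⁅e, f⁆ = h := by
  ext i j
  fin_cases i <;> fin_cases j <;>
    simp [e, f, h, Ring.lie_def, Matrix.mul_apply, Matrix.single]

theorem lie_h_f : ⁅h, f⁆ = (-2 : ℂ) • f := by
  ext i j
  fin_cases i <;> fin_cases j <;>
    simp [f, h, Ring.lie_def, Matrix.mul_apply, Matrix.single]
  norm_num

section TopLevel

variable (k : ℂ) (i : ℕ)

theorem isTop_hwVec : IsTop k (hwVec k i) := fun a n hn => by
  rw [hwVec, ← map_smul, smul_eq_mul, mul_one]
  exact irrMk_eq_zero (Submodule.subset_span (Or.inl ⟨a, n, hn, rfl⟩))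

theorem e_smul_hwVec : gen k e 0 • hwVec k i = 0 := by
  rw [hwVec, ← map_smul, smul_eq_mul, mul_one]
  exact irrMk_eq_zero (Submodule.subset_span (Or.inr (Or.inl rfl)))

theorem h_smul_hwVec : gen k h 0 • hwVec k i = (i : ℂ) • hwVec k i := by
  rw [← sub_eq_zero, ← algebraMap_smul (Env k) (i : ℂ), ← sub_smul, hwVec, ← map_smul,
    smul_eq_mul, mul_one]
  exact irrMk_eq_zero (Submodule.subset_span (Or.inr (Or.inr rfl)))

theorem topVec_zero : topVec k i 0 = hwVec k i := by simp [topVec]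

theorem f_smul_topVec (j : ℕ) :
    gen k f 0 • topVec k i j = ((j : ℂ) + 1) • topVec k i (j + 1) := by
  have : (j.factorial : ℂ) ≠ 0 := by exact_mod_cast j.factorial_ne_zero
  have h' : (j : ℂ) + 1 ≠ 0 := by exact_mod_cast j.succ_ne_zero
  rw [topVec, topVec, gen_smul_smul, smul_smul, smul_smul, ← pow_succ', Nat.factorial_succ]
  congr 1
  push_cast
  field_simp

/-- The recursive form of the divided powers, by which properties of the highest weight vector are
carried down the string. -/
theorem topVec_succ (j : ℕ) :
    topVec k i (j + 1) = ((j : ℂ) + 1)⁻¹ • gen k f 0 • topVec k i j := by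
  have h' : (j : ℂ) + 1 ≠ 0 := by exact_mod_cast j.succ_ne_zero
  rw [f_smul_topVec, inv_smul_smul₀ h']

theorem isTop_topVec (j : ℕ) : IsTop k (topVec k i j) := by
  induction j with
  | zero => rw [topVec_zero]; exact isTop_hwVec k i
  | succ j ih => rw [topVec_succ]; exact (ih.gen_zero_smul f).smul _

theorem h_smul_topVec (j : ℕ) :
    gen k h 0 • topVec k i j = ((i : ℂ) - 2 * j) • topVec k i j := by
  induction j with
  | zero => rw [topVec_zero, h_smul_hwVec]; simp
  | succ j ih =>
    rw [topVec_succ, gen_smul_smul, gen_smul_gen_smul, ih, lie_h_f, gen_smul_smul, gen_smul,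
      smul_assoc]
    -- Both modes are 0, so the delta condition holds; the central term vanishes because of its
    -- factor m = 0.
    simp only [add_zero, Int.cast_zero, zero_mul, ite_self, zero_smul]
    rw [← add_smul, smul_comm]
    congr 1
    push_cast
    ring

/-- The usual recursion from e f = f e + h along the string, starting from e(0)v^i = 0. It uses only
the highest weight relations and needs no bound on j. -/
theorem e_smul_topVec_succ (j : ℕ) :
    gen k e 0 • topVec k i (j + 1) = ((i : ℂ) - j) • topVec k i j := by
  have h' : (j : ℂ) + 1 ≠ 0 := by exact_mod_cast j.succ_ne_zero
  have step : gen k e 0 • gen k f 0 • topVec k i j =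
      (((j : ℂ) + 1) * (i - j)) • topVec k i j := by
    rw [gen_smul_gen_smul, lie_e_f]
    simp only [add_zero, Int.cast_zero, zero_mul, ite_self, zero_smul]
    rw [h_smul_topVec]
    cases j with
    | zero => rw [topVec_zero, e_smul_hwVec]; simp
    | succ j =>
      -- Recursive use of the lemma at the smaller j, for the f e part of e f.
      rw [e_smul_topVec_succ j, gen_smul_smul, f_smul_topVec, smul_smul, ← add_smul]
      congr 1
      push_cast
      ring
  rw [topVec_succ, gen_smul_smul, step, smul_smul]
  congr 1
  field_simp

/-- The reversed form of e(-1)f(-1). The factor j accounts for j = 0, where e(0) already gives zero.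
-/
theorem f_smul_e_smul_topVec (j : ℕ) :
    gen k f 0 • gen k e 0 • topVec k i j = (((i : ℂ) - j + 1) * j) • topVec k i j := by
  cases j with
  | zero => rw [topVec_zero, e_smul_hwVec]; simp
  | succ j =>
    rw [e_smul_topVec_succ, gen_smul_smul, f_smul_topVec, smul_smul]
    congr 1
    push_cast
    ring

/-- Peeling off the outer e and f leaves the eigenvalue of f e one step higher in the string. The
factors j - 1 and j cover the cases in which e(0)² vanishes at the top. -/
theorem f_sq_smul_e_sq_smul_topVec (j : ℕ) :
    gen k f 0 • gen k f 0 • gen k e 0 • gen k e 0 • topVec k i j =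
      (((i : ℂ) - j + 1) * (i - j + 2) * (j - 1) * j) • topVec k i j := by
  cases j with
  | zero => rw [topVec_zero, e_smul_hwVec]; simp
  | succ j =>
    rw [e_smul_topVec_succ, gen_smul_smul, gen_smul_smul, f_smul_e_smul_topVec, gen_smul_smul,
      gen_smul_smul, f_smul_topVec, smul_smul, smul_smul]
    congr 1
    push_cast
    ring

end TopLevel

end AffineSl2

/-! ### Eigenvalues of the four zero modes. -/

theorem mainTheorem5 (k i j : ℕ) (hk : 2 ≤ k) (hik : i ≤ k) (hji : j ≤ i) :
    AffineSl2.component (AffineSl2.omegaVec k) 1 (AffineSl2.Irr k i) (AffineSl2.topVec k i j) =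
        ((1 / (2 * k * (k + 2)) *
          (k * (i - 2 * j) - (i - 2 * j) ^ 2 + 2 * k * (i - j + 1) * j) : ℂ)) •
          AffineSl2.topVec k i j ∧
      AffineSl2.component (AffineSl2.W3 k) 2 (AffineSl2.Irr k i) (AffineSl2.topVec k i j) =
        (k ^ 2 * (i - 2 * j) - 3 * k * (i - 2 * j) ^ 2 + 2 * (i - 2 * j) ^ 3
          - 6 * k * (i - 2 * j) * (i - j + 1) * j : ℂ) • AffineSl2.topVec k i j ∧
      AffineSl2.component (AffineSl2.W4 k) 3 (AffineSl2.Irr k i) (AffineSl2.topVec k i j) =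
        (2 * k ^ 2 * (k ^ 2 + k + 1) * (i - 2 * j)
          - k * (13 * k ^ 2 + 8 * k + 2) * (i - 2 * j) ^ 2
          + 2 * k * (11 * k + 6) * (i - 2 * j) ^ 3
          - (11 * k + 6) * (i - 2 * j) ^ 4
          + 4 * k ^ 2 * (k - 3) * (k - 2) * (i - j + 1) * j
          - 4 * k ^ 2 * (6 * k - 5) * (i - 2 * j) * (i - j + 1) * j
          + 4 * k * (11 * k + 6) * (i - 2 * j) ^ 2 * (i - j + 1) * j
          - 2 * k ^ 2 * (6 * k - 5) * (i - j + 1) * (i - j + 2) * (j - 1) * j : ℂ) •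
          AffineSl2.topVec k i j ∧
      AffineSl2.component (AffineSl2.W5 k) 4 (AffineSl2.Irr k i) (AffineSl2.topVec k i j) =
        (-2 * k ^ 3 * (k ^ 2 + 3 * k + 5) * (i - 2 * j)
          + 5 * k ^ 2 * (5 * k ^ 2 + 6 * k + 6) * (i - 2 * j) ^ 2
          - 20 * k * (4 * k ^ 2 + 3 * k + 1) * (i - 2 * j) ^ 3
          + 5 * k * (19 * k + 12) * (i - 2 * j) ^ 4
          - 2 * (19 * k + 12) * (i - 2 * j) ^ 5
          + 10 * k ^ 2 * (5 * k ^ 2 - 14 * k + 20) * (i - 2 * j) * (i - j + 1) * j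
          - 20 * k ^ 2 * (10 * k - 7) * (i - 2 * j) ^ 2 * (i - j + 1) * j
          + 10 * k * (19 * k + 12) * (i - 2 * j) ^ 3 * (i - j + 1) * j
          - 10 * k ^ 2 * (10 * k - 7) * (i - 2 * j) * (i - j + 1) * (i - j + 2) * (j - 1) * j : ℂ) •
          AffineSl2.topVec k i j := by
  have hv := AffineSl2.isTop_topVec k i j
  refine ⟨?_, ?_, ?_, ?_⟩
  all_goals
    simp only [AffineSl2.omegaVec, AffineSl2.W3, AffineSl2.W4, AffineSl2.W5,
      AffineSl2.component_add, AffineSl2.component_sub, AffineSl2.component_smul]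
    -- The discharger checks, word by word, that all modes are negative and that the index 1, 2, 3
    -- or 4 is the weight minus one.
    simp (discharger := simp [AffineSl2.wordWeight]) only [AffineSl2.component_word hv]
    -- The reversal lets each h(0) meet v^{i,j} directly; what is left is f e or f f e e on that
    -- same vector.
    simp only [AffineSl2.revAct, AffineSl2.gen_smul_smul, AffineSl2.h_smul_topVec,
      AffineSl2.f_smul_e_smul_topVec, AffineSl2.f_sq_smul_e_sq_smul_topVec]
    simp only [smul_smul, ← add_smul, ← sub_smul]
    congr 1
    -- This evaluates the signs (-1)^|n+1|. The excluded lemma would turn an equation with a common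
    -- left factor, such as 1/(2k(k+2)) for ω, into a disjunction that `ring` cannot treat.
    norm_num [-mul_eq_mul_left_iff]
    ring
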